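/- Let $\mathfrak g$ be a finite-dimensional semisimple complex Lie algebra, i.e. $\mathfrak g=\mathfrak s_1\oplus\cdots\oplus\mathfrak s_\ell$ with simple ideals $\mathfrak s_1,\dots,\mathfrak s_\ell$; the number $\ell$ of simple ideals is called the length of $\mathfrak g$. Let $\mu(\mathfrak g)$ denote the minimal dimension of a faithful linear representation of $\mathfrak g$, i.e. the least integer $r\ge 0$ for which there is an injective Lie algebra homomorphism $\mathfrak g\to\mathfrak{gl}_r(\mathbb C)$. Let $n\ge\mu(\mathfrak g)$ be an integer and let $\mathfrak a$ be a complex Lie algebra. Then there is an injective homomorphism of complex Lie algebras $$\mathfrak g\oplus\mathfrak a\hookrightarrow\mathfrak{gl}_n(\mathbb C)$$ if and only if there is an injective homomorphism of complex Lie algebras $$\mathfrak a\hookrightarrow\mathfrak{gl}_{n-\mu(\mathfrak g)}(\mathbb C)\oplus\mathbb C^{\ell},$$ where $\mathbb C^\ell$ is the abelian Lie algebra of dimension $\ell$ and $\oplus$ is the direct sum of Lie algebras. -/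

import Mathlib

/- Associative rings (in particular the matrix ring `Matrix (Fin n) (Fin n) ℂ`, which then is
`𝔤𝔩ₙ(ℂ)`, and the commutative ring `Fin ℓ → ℂ`, which then is the abelian Lie algebra `ℂ^ℓ`)
carry the commutator bracket `⁅x, y⁆ = x * y - y * x`. Products carry the componentwise bracket. -/
attribute [local instance 100] LieRing.ofAssociativeRing

namespace FaithfulRep

/-- `L` can be embedded into `L'`: there is an injective homomorphism of Lie algebras over `K`. -/
def Embeds (K : Type*) [Field K] (L L' : Type*) [LieRing L] [LieAlgebra K L]
    [LieRing L'] [LieAlgebra K L'] : Prop :=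
  ∃ f : L →ₗ⁅K⁆ L', Function.Injective f

/-- The minimal dimension of a faithful linear representation of `L` over `K`, that is the least
`n` such that there is an injective Lie algebra homomorphism `L → 𝔤𝔩ₙ(K)`. -/
noncomputable def mu (K : Type*) [Field K] (L : Type*) [LieRing L] [LieAlgebra K L] : ℕ :=
  sInf {n : ℕ | Embeds K L (Matrix (Fin n) (Fin n) K)}

/-- The length of `L`: the number of simple ideals of `L`, that is of ideals which are simple
as Lie algebras. -/
noncomputable def length (K : Type*) [Field K] (L : Type*) [LieRing L] [LieAlgebra K L] : ℕ :=
  {I : LieIdeal K L | LieAlgebra.IsSimple K I}.ncard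

/-- The set whose infimum defines `mu` is non-empty for a finite-dimensional semisimple `L`
(adjoint representation), hence `mu` is attained there. -/
theorem embeds_mu (K : Type*) [Field K] (L : Type*) [LieRing L] [LieAlgebra K L]
    [FiniteDimensional K L] [LieAlgebra.IsSemisimple K L] :
    Embeds K L (Matrix (Fin (mu K L)) (Fin (mu K L)) K) := by
  have h : {n : ℕ | Embeds K L (Matrix (Fin n) (Fin n) K)}.Nonempty := by
    refine ⟨Module.finrank K L, ?_⟩
    let e : L ≃ₗ[K] (Fin (Module.finrank K L) → K) := (Module.finBasis K L).equivFun
    refine ⟨(lieEquivMatrix'.toLieHom.comp (e.lieConj.toLieHom)).comp (LieAlgebra.ad K L), ?_⟩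
    have hi : Function.Injective (LieAlgebra.ad K L) := by
      rw [← LieHom.ker_eq_bot]
      exact LieAlgebra.ad_ker_eq_bot_of_hasTrivialRadical K L
    exact (lieEquivMatrix'.injective.comp e.lieConj.injective).comp hi
  exact Nat.sInf_mem h

end FaithfulRep

/-! # Faithful representations of direct sums with a semisimple Lie algebra

Weyl's theorem for simple Lie algebras is used to compress the centralizer of a faithful
representation; the minimal dimension `mu` is then additive over the simple ideals. -/

/-! The heart is a bound on centralizers. Let a simple `L` act faithfully on `V`. By Weyl's theorem
`V` is semisimple over the associative algebra generated by `L`, and by Schur's lemma an isotypic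
component `U^k` contributes `gl_k` to the commutant. Choose a simple `U` on which `L` acts
nontrivially, hence faithfully, so that `dim U` is at least `mu` and at least 2. If `k = 1`, this
component contributes a single scalar; if `k ≥ 2`, then `gl_k` and the rest of the commutant fit
together into `gl` of size `dim V - dim U`. Either way the centralizer embeds into `gl_{dim V - mu}
× K` (`embeds_centralizer_end`).

A faithful representation of `𝔤 ⊕ 𝔞` is a family of commuting actions of the simple ideals and of
`𝔞`. Peeling off one ideal at a time costs its `mu` in dimension and yields one abelian coordinate
(`exists_lieHom_of_commuting`). Conversely, minimal representations of the ideals, each shifted by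
its own scalar, are placed in diagonal blocks next to `gl_m` (`embeds_prod_matrix`). For `𝔤` alone
both constructions together give additivity of `mu` (`sum_mu_eq_mu`), which makes the sizes match.
-/

open LieAlgebra LieModule

/-! ### Trace forms of simple Lie algebras. -/

section
variable {K L : Type*} [Field K] [LieRing L] [LieAlgebra K L]

theorem LieAlgebra.IsSimple.lie_top_top_eq_top [IsSimple K L] :
    ⁅(⊤ : LieIdeal K L), (⊤ : LieIdeal K L)⁆ = ⊤ := by
  refine (IsSimple.eq_bot_or_eq_top _).resolve_left fun h => IsSimple.non_abelian K (L := L) ?_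
  refine ⟨fun x y => ?_⟩
  have : ⁅x, y⁆ ∈ ⁅(⊤ : LieIdeal K L), (⊤ : LieIdeal K L)⁆ :=
    LieSubmodule.lie_mem_lie (LieSubmodule.mem_top x) (LieSubmodule.mem_top y)
  rwa [h, LieSubmodule.mem_bot] at this

theorem LieAlgebra.IsSimple.eq_zero_of_forall_lie_eq_zero [IsSimple K L] {N : Type*}
    [AddCommGroup N] [Module K N] (d : L →ₗ[K] N) (h : ∀ x y : L, d ⁅x, y⁆ = 0) : d = 0 := by
  ext x
  have hx : x ∈ ⁅(⊤ : LieIdeal K L), (⊤ : LieIdeal K L)⁆ := by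
    rw [IsSimple.lie_top_top_eq_top]; trivial
  rw [← LieSubmodule.mem_toSubmodule, LieSubmodule.lieIdeal_oper_eq_linear_span'] at hx
  have : Submodule.span K {z : L | ∃ x ∈ (⊤ : LieIdeal K L), ∃ n ∈ (⊤ : LieIdeal K L), ⁅(x : L), (n : L)⁆ = z}
      ≤ LinearMap.ker d := by
    rw [Submodule.span_le]
    rintro _ ⟨x, -, y, -, rfl⟩
    exact h x y
  exact this hx

theorem LieAlgebra.IsSimple.injective_of_ne_zero [IsSimple K L] {L' : Type*} [LieRing L']
    [LieAlgebra K L'] (f : L →ₗ⁅K⁆ L') (hf : f ≠ 0) : Function.Injective f := by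
  rw [← LieHom.ker_eq_bot]
  refine (IsSimple.eq_bot_or_eq_top _).resolve_right fun h => hf ?_
  ext x
  have : x ∈ f.ker := h ▸ LieSubmodule.mem_top x
  simpa using this

variable [CharZero K] [FiniteDimensional K L] [IsSimple K L]
variable {M : Type*} [AddCommGroup M] [Module K M] [LieRingModule L M] [LieModule K L M]
  [FiniteDimensional K M]

/-- If the form vanished, `[L, L] = L` would act by nilpotent endomorphisms. The action is faithful,
so every `ad x` would be nilpotent too, and Engel's theorem would make `L` nilpotent. -/
theorem LieModule.traceForm_ne_zero_of_isSimple (hM : ¬ IsTrivial L M) :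
    traceForm K L M ≠ 0 := by
  intro h
  have h1 := isNilpotent_derivedSeries_of_traceForm_eq_zero h
  rw [isNilpotent_iff_forall' (R := K)] at h1
  have htop : derivedSeries K L 1 = ⊤ := IsSimple.lie_top_top_eq_top
  have h2 : ∀ x : L, _root_.IsNilpotent (toEnd K L M x) := fun x => by
    have := h1 ⟨x, htop ▸ LieSubmodule.mem_top x⟩
    exact this
  have hinj : Function.Injective (toEnd K L M) := by
    refine IsSimple.injective_of_ne_zero _ fun h0 => hM ⟨fun x m => ?_⟩
    rw [← toEnd_apply_apply K, h0]; rfl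
  have h3 : LieRing.IsNilpotent L := by
    rw [LieAlgebra.isNilpotent_iff_forall (R := K)]
    intro x
    have h4 := LieAlgebra.ad_nilpotent_of_nilpotent (R := K) (h2 x)
    obtain ⟨k, hk⟩ := h4
    refine ⟨k, ?_⟩
    ext y
    apply hinj
    have : ∀ k y, toEnd K L M ((ad K L x ^ k) y) = (ad K _ (toEnd K L M x) ^ k) (toEnd K L M y) := by
      intro k
      induction k with
      | zero => intro y; rfl
      | succ k ih => intro y; simp [pow_succ, ih]
    rw [this, hk]; simp
  have h4 : IsSolvable L := inferInstance
  have h5 : (⊤ : LieIdeal K L) = ⊥ := by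
    refine HasTrivialRadical.eq_bot_of_isSolvable _
  have := IsSimple.nontrivial K L
  exact top_ne_bot h5

/-- The radical of an invariant form is an ideal, and it is not all of `L`. -/
theorem LieModule.traceForm_nondegenerate_of_isSimple (hM : ¬ IsTrivial L M) :
    (traceForm K L M).Nondegenerate := by
  have hinv := traceForm_lieInvariant K L M
  let I := LieAlgebra.InvariantForm.orthogonal (traceForm K L M) hinv ⊤
  have hI : I = ⊥ := by
    refine (IsSimple.eq_bot_or_eq_top _).resolve_right fun h =>
      traceForm_ne_zero_of_isSimple (K := K) hM ?_
    ext x y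
    have : y ∈ I := h ▸ LieSubmodule.mem_top y
    exact (LieAlgebra.InvariantForm.mem_orthogonal _ _ _ _).1 this x trivial
  have key : ∀ y, (∀ x, traceForm K L M x y = 0) → y = 0 := fun y hy => by
    have : y ∈ I := (LieAlgebra.InvariantForm.mem_orthogonal _ _ _ _).2 fun x _ => hy x
    rwa [hI, LieSubmodule.mem_bot] at this
  exact ⟨fun x hx => key x fun y => by rw [traceForm_comm]; exact hx y, key⟩
end

/-! ### Casimir operators and Whitehead's first lemma. -/

section
variable {K L : Type*} [Field K] [LieRing L] [LieAlgebra K L]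

/-- The tensor `∑ bᵢ ⊗ bⁱ` of a basis and its dual basis with respect to an invariant form is
invariant. -/
theorem LinearMap.BilinForm.sum_lie_dualBasis {ι : Type*} [Fintype ι] [DecidableEq ι]
    (B : LinearMap.BilinForm K L) (hB : B.Nondegenerate) (hinv : B.lieInvariant L)
    (b : Module.Basis ι K L) {N : Type*} [AddCommGroup N] [Module K N] (F : L →ₗ[K] L →ₗ[K] N)
    (x : L) :
    ∑ i, (F ⁅x, b i⁆ (B.dualBasis hB b i) + F (b i) ⁅x, B.dualBasis hB b i⁆) = 0 := by
  set b' := B.dualBasis hB b with hb'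
  have h1 : ∀ i, ⁅x, b i⁆ = ∑ j, B (b' j) ⁅x, b i⁆ • b j := fun i => by
    conv_lhs => rw [← b.sum_repr ⁅x, b i⁆]
    refine Finset.sum_congr rfl fun j _ => ?_
    congr 1
    conv_rhs => rw [← b.sum_repr ⁅x, b i⁆]
    simp only [map_sum, map_smul, hb', LinearMap.BilinForm.apply_dualBasis_left, smul_eq_mul,
      mul_ite, mul_one, mul_zero, Finset.sum_ite_eq', Finset.mem_univ, if_true]
  have h2 : ∀ i, ⁅x, b' i⁆ = ∑ j, B ⁅x, b' i⁆ (b j) • b' j := fun i => by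
    conv_lhs => rw [← b'.sum_repr ⁅x, b' i⁆]
    simp [hb', LinearMap.BilinForm.dualBasis_repr_apply]
  have h3 : ∑ i, F ⁅x, b i⁆ (b' i) = ∑ i, ∑ j, B (b' j) ⁅x, b i⁆ • F (b j) (b' i) := by
    refine Finset.sum_congr rfl fun i _ => ?_
    conv_lhs => rw [h1 i]
    simp
  have h4 : ∑ i, F (b i) ⁅x, b' i⁆ = ∑ i, ∑ j, B ⁅x, b' i⁆ (b j) • F (b i) (b' j) := by
    refine Finset.sum_congr rfl fun i _ => ?_
    conv_lhs => rw [h2 i]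
    simp
  rw [Finset.sum_add_distrib, h3, h4, Finset.sum_comm, ← Finset.sum_add_distrib]
  refine Finset.sum_eq_zero fun i _ => ?_
  rw [← Finset.sum_add_distrib]
  refine Finset.sum_eq_zero fun j _ => ?_
  -- Invariance says that the matrices of `ad x` in the two dual bases are negative transposes of
  -- each other.
  rw [hinv, neg_smul, add_neg_eq_zero.2 rfl]

variable [CharZero K] [FiniteDimensional K L] [IsSimple K L]

/-- The first cohomology of a simple Lie algebra with coefficients in a finite-dimensional module
vanishes. -/
theorem LieModule.exists_eq_lie_of_isSimple {M : Type*} [AddCommGroup M] [Module K M]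
    [LieRingModule L M] [LieModule K L M] [FiniteDimensional K M] (d : L →ₗ[K] M)
    (hd : ∀ x y : L, d ⁅x, y⁆ = ⁅x, d y⁆ - ⁅y, d x⁆) : ∃ m : M, ∀ x, d x = ⁅x, m⁆ := by
  induction hn : Module.finrank K M using Nat.strong_induction_on generalizing M with
  | _ n ih =>
  by_cases hM : IsTrivial L M
  · have : d = 0 := IsSimple.eq_zero_of_forall_lie_eq_zero d fun x y => by
      rw [hd, hM.trivial, hM.trivial, sub_zero]
    exact ⟨0, by simp [this]⟩
  classical
  have hB := traceForm_nondegenerate_of_isSimple (K := K) hM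
  set B := traceForm K L M
  have hinv : B.lieInvariant L := traceForm_lieInvariant K L M
  let b := Module.finBasis K L
  let b' := LinearMap.BilinForm.dualBasis B hB b
  -- The Casimir operator of the trace form of `M` itself: it commutes with `L` and has trace `dim L
  -- ≠ 0`.
  let c : Module.End K M := ∑ i, toEnd K L M (b i) * toEnd K L M (b' i)
  have hc : ∀ m, c m = ∑ i, ⁅b i, ⁅b' i, m⁆⁆ := fun m => by simp [c]
  have hcomm : ∀ (x : L) (m : M), c ⁅x, m⁆ = ⁅x, c m⁆ := by
    intro x m
    let F : L →ₗ[K] L →ₗ[K] M := LinearMap.mk₂ K (fun y z => ⁅y, ⁅z, m⁆⁆)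
      (by simp) (by simp) (by simp) (by simp)
    have h := LinearMap.BilinForm.sum_lie_dualBasis B hB hinv b F x
    rw [hc, hc, lie_sum, ← sub_eq_zero, ← Finset.sum_sub_distrib, ← neg_eq_zero, ← h,
      ← Finset.sum_neg_distrib]
    refine Finset.sum_congr rfl fun i _ => ?_
    simp only [F, LinearMap.mk₂_apply]
    rw [lie_lie x (b i), lie_lie x, lie_sub]
    simp only [b']
    abel
  have hc0 : c ≠ 0 := by
    intro h0
    have : LinearMap.trace K M c = Module.finrank K L := by
      simp only [c, map_sum]
      have : ∀ i, LinearMap.trace K M (toEnd K L M (b i) * toEnd K L M (b' i)) = 1 := fun i => by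
        have := LinearMap.BilinForm.apply_dualBasis_left (B := B) hB b i i
        rw [if_pos rfl] at this
        rw [LinearMap.trace_mul_comm]
        exact this
      simp [this]
    rw [h0, map_zero] at this
    have h1 := IsSimple.nontrivial K L
    have h2 : 0 < Module.finrank K L := Module.finrank_pos
    exact h2.ne (by exact_mod_cast this)
  let N : LieSubmodule K L M :=
    { LinearMap.ker c with
      lie_mem := fun {x m} hm => by
        have hm : c m = 0 := hm
        change c ⁅x, m⁆ = 0
        rw [hcomm, hm, lie_zero] }
  by_cases hN : N = ⊥
  -- The cocycle identity and invariance of the dual-basis tensor give `⁅x, m⁆ = c (d x)`, so `c⁻¹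
  -- m` is the required vector.
  · let m := ∑ i, ⁅b i, d (b' i)⁆
    have hinj : Function.Injective c := by
      rw [← LinearMap.ker_eq_bot, eq_bot_iff]
      intro m hm
      have : m ∈ N := hm
      rwa [hN, LieSubmodule.mem_bot] at this
    obtain ⟨m', hm'⟩ := LinearMap.surjective_of_injective hinj m
    refine ⟨m', fun x => hinj ?_⟩
    rw [hcomm, hm']
    let F : L →ₗ[K] L →ₗ[K] M := LinearMap.mk₂ K (fun y z => ⁅y, d z⁆)
      (by simp) (by simp) (by simp) (by simp)
    have h := LinearMap.BilinForm.sum_lie_dualBasis B hB hinv b F x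
    rw [hc, lie_sum, ← sub_eq_zero, ← Finset.sum_sub_distrib, ← neg_eq_zero, ← h,
      ← Finset.sum_neg_distrib]
    refine Finset.sum_congr rfl fun i _ => ?_
    simp only [F, LinearMap.mk₂_apply]
    rw [lie_lie x (b i), hd, lie_sub]
    simp only [b']
    abel
  -- Here `ker c` is a nonzero proper submodule: solve in the quotient, lift, and correct the error,
  -- a cocycle with values in `N`.
  · have hN' : (N : Submodule K M) ≠ ⊤ := fun h => hc0 (LinearMap.ker_eq_top.1 h)
    have hlt : Module.finrank K N < n := hn ▸ Submodule.finrank_lt hN'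
    have hpos : 0 < Module.finrank K N :=
      Module.finrank_pos_iff.2 ((LieSubmodule.nontrivial_iff_ne_bot K L M).2 hN)
    have hquot : Module.finrank K (M ⧸ N) < n := by
      have := Submodule.finrank_quotient_add_finrank (N : Submodule K M)
      have h' : Module.finrank K (M ⧸ N) + Module.finrank K N = Module.finrank K M := this
      omega
    have : FiniteDimensional K (M ⧸ N) :=
      inferInstanceAs (FiniteDimensional K (M ⧸ (N : Submodule K M)))
    obtain ⟨q, hq⟩ := ih _ hquot ((LieSubmodule.Quotient.mk' N : M →ₗ[K] M ⧸ N) ∘ₗ d)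
      (fun x y => by
        change LieSubmodule.Quotient.mk' N (d ⁅x, y⁆) =
          ⁅x, LieSubmodule.Quotient.mk' N (d y)⁆ - ⁅y, LieSubmodule.Quotient.mk' N (d x)⁆
        rw [hd, map_sub, LieModuleHom.map_lie, LieModuleHom.map_lie]) rfl
    obtain ⟨m₀, rfl⟩ := LieSubmodule.Quotient.surjective_mk' N q
    have hmem : ∀ x, d x - ⁅x, m₀⁆ ∈ N := fun x => by
      rw [← LieSubmodule.Quotient.mk_eq_zero', ← LieSubmodule.Quotient.mk'_apply, map_sub,
        LieModuleHom.map_lie, ← hq]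
      exact sub_self _
    let d' : L →ₗ[K] N := LinearMap.codRestrict (N : Submodule K M)
      (d - ((toEnd K L M : L →ₗ[K] Module.End K M).flip m₀)) hmem
    have hd' : ∀ x, (d' x : M) = d x - ⁅x, m₀⁆ := fun x => rfl
    obtain ⟨m₁, hm₁⟩ := ih _ hlt d' (fun x y => by
      ext
      simp only [hd', hd, LieSubmodule.coe_sub, LieSubmodule.coe_bracket, lie_sub, lie_lie]
      abel) rfl
    refine ⟨m₀ + m₁, fun x => ?_⟩
    have := congrArg (Subtype.val) (hm₁ x)
    rw [hd', LieSubmodule.coe_bracket] at this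
    rw [lie_add, ← this]
    abel
end

/-! ### Complete reducibility. -/

section
variable {K L : Type*} [Field K] [LieRing L] [LieAlgebra K L]
variable [CharZero K] [FiniteDimensional K L] [IsSimple K L]

/-- **Weyl's theorem** on complete reducibility, for simple Lie algebras. -/
theorem LieSubmodule.exists_isCompl_of_isSimple {V : Type*} [AddCommGroup V] [Module K V]
    [LieRingModule L V] [LieModule K L V] [FiniteDimensional K V] (W : LieSubmodule K L V) :
    ∃ W' : LieSubmodule K L V, IsCompl (W : Submodule K V) (W' : Submodule K V) := by
  obtain ⟨q, hq⟩ := (W : Submodule K V).subtype.exists_leftInverse_of_injective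
    (Submodule.ker_subtype _)
  have hqW : ∀ w ∈ W, (q w : V) = w := fun w hw =>
    congrArg Subtype.val (LinearMap.congr_fun hq ⟨w, hw⟩)
  let p : Module.End K V := (W : Submodule K V).subtype ∘ₗ q
  have hp : ∀ v, p v ∈ W := fun v => (q v).2
  have hpW : ∀ w ∈ W, p w = w := hqW
  -- The linear projection `p` onto `W` is not in `N`, but every `⁅x, p⁆` is. Writing this cocycle
  -- as `⁅x, φ⁆` with `φ ∈ N` makes `p - φ` an equivariant projection onto `W`.
  let N : LieSubmodule K L (Module.End K V) :=
    { carrier := {φ | (∀ v, φ v ∈ W) ∧ ∀ w ∈ W, φ w = 0}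
      add_mem' := fun {a b} ha hb => ⟨fun v => W.add_mem (ha.1 v) (hb.1 v),
        fun w hw => by simp [ha.2 w hw, hb.2 w hw]⟩
      zero_mem' := ⟨fun v => W.zero_mem, fun w _ => rfl⟩
      smul_mem' := fun c a ha => ⟨fun v => W.smul_mem c (ha.1 v),
        fun w hw => by simp [ha.2 w hw]⟩
      lie_mem := fun {x φ} hφ => ⟨fun v => by
          rw [LieHom.lie_apply]
          exact W.sub_mem (W.lie_mem (hφ.1 _)) (hφ.1 _),
        fun w hw => by
          rw [LieHom.lie_apply, hφ.2 w hw, hφ.2 _ (W.lie_mem hw), lie_zero, sub_zero]⟩ }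
  have hmem : ∀ x : L, ⁅x, p⁆ ∈ N := fun x => by
    refine ⟨fun v => ?_, fun w hw => ?_⟩
    · rw [LieHom.lie_apply]
      exact W.sub_mem (W.lie_mem (hp _)) (hp _)
    · rw [LieHom.lie_apply, hpW w hw, hpW _ (W.lie_mem hw), sub_self]
  let d : L →ₗ[K] N := LinearMap.codRestrict (N : Submodule K (Module.End K V))
    ((toEnd K L (Module.End K V) : L →ₗ[K] Module.End K (Module.End K V)).flip p) hmem
  have hd : ∀ x, (d x : Module.End K V) = ⁅x, p⁆ := fun x => rfl
  obtain ⟨⟨φ, hφ⟩, h⟩ := LieModule.exists_eq_lie_of_isSimple d fun x y => by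
    ext1
    simp only [hd, LieSubmodule.coe_sub, LieSubmodule.coe_bracket, lie_lie]
  have hcomm : ∀ (x : L) v, (p - φ) ⁅x, v⁆ = ⁅x, (p - φ) v⁆ := fun x v => by
    have := LinearMap.congr_fun (congrArg Subtype.val (h x)) v
    rw [hd, LieSubmodule.coe_bracket, LieHom.lie_apply, LieHom.lie_apply] at this
    simp only [LinearMap.sub_apply, lie_sub]
    rw [sub_eq_sub_iff_sub_eq_sub] at this
    exact this.symm
  have hφ1 : ∀ v, φ v ∈ W := hφ.1
  have hφ2 : ∀ w ∈ W, φ w = 0 := hφ.2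
  let W' : LieSubmodule K L V :=
    { LinearMap.ker (p - φ) with
      lie_mem := fun {x v} hv => by
        have hv : (p - φ) v = 0 := hv
        change (p - φ) ⁅x, v⁆ = 0
        rw [hcomm, hv, lie_zero] }
  refine ⟨W', ?_⟩
  have hW' : ∀ v, v ∈ (W' : Submodule K V) ↔ (p - φ) v = 0 := fun v => Iff.rfl
  have hid : ∀ w ∈ W, (p - φ) w = w := fun w hw => by
    rw [LinearMap.sub_apply, hpW w hw, hφ2 w hw, sub_zero]
  have hin : ∀ v, (p - φ) v ∈ W := fun v => W.sub_mem (hp v) (hφ1 v)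
  constructor
  · rw [Submodule.disjoint_def]
    intro v hv hv'
    rw [← hid v hv]
    exact hv'
  · rw [codisjoint_iff, eq_top_iff]
    intro v _
    refine Submodule.mem_sup.2 ⟨(p - φ) v, hin v, v - (p - φ) v, ?_, by abel⟩
    rw [hW', map_sub, hid _ (hin v), sub_self]

omit [CharZero K] [FiniteDimensional K L] [IsSimple K L] in
theorem LieSubmodule.apply_mem_of_mem_adjoin_range_toEnd {V : Type*} [AddCommGroup V] [Module K V]
    [LieRingModule L V] [LieModule K L V] (W : LieSubmodule K L V) {r : Module.End K V}
    (hr : r ∈ Algebra.adjoin K (Set.range (toEnd K L V))) {v : V} (hv : v ∈ W) : r v ∈ W := by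
  induction hr using Algebra.adjoin_induction generalizing v with
  | mem r hr => obtain ⟨x, rfl⟩ := hr; exact W.lie_mem hv
  | algebraMap c => exact W.smul_mem c hv
  | add a b _ _ ha hb => exact W.add_mem (ha hv) (hb hv)
  | mul a b _ _ ha hb => exact ha (hb hv)

variable (K L) in
/-- A finite-dimensional module over a simple Lie algebra is semisimple over the associative
algebra generated by the action. -/
theorem LieModule.isSemisimpleModule_adjoin_range_toEnd (V : Type*) [AddCommGroup V] [Module K V]
    [LieRingModule L V] [LieModule K L V] [FiniteDimensional K V] :
    IsSemisimpleModule (Algebra.adjoin K (Set.range (toEnd K L V))) V := by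
  refine (isSemisimpleModule_iff _ _).2 ⟨fun W => ?_⟩
  let W₀ : LieSubmodule K L V :=
    { W.restrictScalars K with
      lie_mem := fun {x v} hv =>
        W.smul_mem (⟨toEnd K L V x, Algebra.subset_adjoin ⟨x, rfl⟩⟩ :
          Algebra.adjoin K (Set.range (toEnd K L V))) hv }
  obtain ⟨W', hW'⟩ := W₀.exists_isCompl_of_isSimple
  let W₁ : Submodule (Algebra.adjoin K (Set.range (toEnd K L V))) V :=
    { (W' : Submodule K V) with
      smul_mem' := fun r _ hv => W'.apply_mem_of_mem_adjoin_range_toEnd r.2 hv }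
  refine ⟨W₁, ?_⟩
  constructor
  · rw [Submodule.disjoint_def]
    intro v hv hv'
    exact (Submodule.disjoint_def.1 hW'.1) v hv hv'
  · rw [codisjoint_iff, eq_top_iff]
    intro v _
    have : v ∈ (W₀ : Submodule K V) ⊔ (W' : Submodule K V) := by
      rw [codisjoint_iff.1 hW'.2]; trivial
    obtain ⟨a, ha, b, hb, rfl⟩ := Submodule.mem_sup.1 this
    exact Submodule.mem_sup.2 ⟨a, ha, b, hb, rfl⟩
end

/-! ### Embeddings into matrix algebras and commutants of semisimple modules. -/

namespace FaithfulRep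
section
variable {K : Type*} [Field K]

theorem Embeds.trans {L₁ L₂ L₃ : Type*} [LieRing L₁] [LieAlgebra K L₁] [LieRing L₂]
    [LieAlgebra K L₂] [LieRing L₃] [LieAlgebra K L₃] (h : Embeds K L₁ L₂) (h' : Embeds K L₂ L₃) :
    Embeds K L₁ L₃ :=
  let ⟨f, hf⟩ := h
  let ⟨g, hg⟩ := h'
  ⟨g.comp f, hg.comp hf⟩

theorem Embeds.prodMap {L₁ L₂ L₃ L₄ : Type*} [LieRing L₁] [LieAlgebra K L₁] [LieRing L₂]
    [LieAlgebra K L₂] [LieRing L₃] [LieAlgebra K L₃] [LieRing L₄] [LieAlgebra K L₄]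
    (h : Embeds K L₁ L₂) (h' : Embeds K L₃ L₄) : Embeds K (L₁ × L₃) (L₂ × L₄) :=
  let ⟨f, hf⟩ := h
  let ⟨g, hg⟩ := h'
  ⟨f.prodMap g, hf.prodMap hg⟩

theorem Embeds.of_algHom {A B : Type*} [Ring A] [Algebra K A] [Ring B] [Algebra K B]
    (f : A →ₐ[K] B) (hf : Function.Injective f) : Embeds K A B :=
  ⟨f.toLieHom, hf⟩

/-- Associative algebra homomorphisms which need not preserve the unit are Lie homomorphisms. -/
theorem Embeds.of_nonUnitalAlgHom {A B : Type*} [Ring A] [Algebra K A] [Ring B] [Algebra K B]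
    (f : A →ₙₐ[K] B) (hf : Function.Injective f) : Embeds K A B :=
  ⟨{ toFun := f
     map_add' := map_add f
     map_smul' := map_smul f
     map_lie' := fun {x y} => by
      simp only [LieRing.of_associative_ring_bracket, map_sub, map_mul] }, hf⟩

theorem embeds_matrix_prod {ι κ : Type*} [Fintype ι] [DecidableEq ι] [Fintype κ] [DecidableEq κ]
    {m : ℕ} (h : Fintype.card ι + Fintype.card κ ≤ m) :
    Embeds K (Matrix ι ι K × Matrix κ κ K) (Matrix (Fin m) (Fin m) K) := by
  obtain ⟨k, rfl⟩ := Nat.exists_eq_add_of_le h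
  let e : (ι ⊕ κ) ⊕ Fin k ≃ Fin (Fintype.card ι + Fintype.card κ + k) :=
    Fintype.equivFinOfCardEq (by simp)
  refine Embeds.trans (L₂ := Matrix ((ι ⊕ κ) ⊕ Fin k) ((ι ⊕ κ) ⊕ Fin k) K)
    (Embeds.of_nonUnitalAlgHom
      { toFun := fun A => Matrix.fromBlocks (Matrix.fromBlocks A.1 0 0 A.2) 0 0 0
        map_smul' := fun c A => by simp [Matrix.fromBlocks_smul]
        map_zero' := by simp
        map_add' := fun A B => by simp [Matrix.fromBlocks_add]
        map_mul' := fun A B => by simp [Matrix.fromBlocks_multiply] } ?_)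
    (Embeds.of_algHom (Matrix.reindexAlgEquiv K K e).toAlgHom
      (Matrix.reindexAlgEquiv K K e).injective)
  intro A B hAB
  have h1 := (Matrix.fromBlocks_inj.1 hAB).1
  have h2 := Matrix.fromBlocks_inj.1 h1
  exact Prod.ext h2.1 h2.2.2.2

theorem embeds_matrix {ι : Type*} [Fintype ι] [DecidableEq ι] {m : ℕ} (h : Fintype.card ι ≤ m) :
    Embeds K (Matrix ι ι K) (Matrix (Fin m) (Fin m) K) :=
  Embeds.trans ⟨LieHom.inl K _ (Matrix (Fin 0) (Fin 0) K), LieHom.inl_injective⟩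
    (embeds_matrix_prod (by simpa using h))

theorem embeds_end_matrix {V : Type*} [AddCommGroup V] [Module K V] [FiniteDimensional K V] :
    Embeds K (Module.End K V)
      (Matrix (Fin (Module.finrank K V)) (Fin (Module.finrank K V)) K) :=
  Embeds.of_algHom (LinearMap.toMatrixAlgEquiv (Module.finBasis K V)).toAlgHom
    (LinearMap.toMatrixAlgEquiv (Module.finBasis K V)).injective

variable {R : Type*} [Ring R] [Algebra K R] {V : Type*} [AddCommGroup V]
  [Module K V] [Module R V] [IsScalarTower K R V]

/-- Restriction to an isotypic component and passing to the quotient by it is faithful on the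
endomorphisms of a semisimple module. -/
theorem embeds_end_prod_of_isotypicComponent [IsSemisimpleModule R V] (U : Submodule R V)
    [IsSimpleModule R U] :
    Embeds K (Module.End R V) (Module.End R (isotypicComponent R V U) ×
      Module.End K (V ⧸ (isotypicComponent R V U).restrictScalars K)) := by
  set c := isotypicComponent R V U
  have hcinv : c.IsFullyInvariant := Submodule.IsFullyInvariant.isotypicComponent R V U
  let f₁ : Module.End R V →ₗ⁅K⁆ Module.End R c :=
    { toFun := fun a => a.restrict (hcinv a)
      map_add' := fun _ _ => rfl
      map_smul' := fun _ _ => rfl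
      map_lie' := rfl }
  let f₂ : Module.End R V →ₗ⁅K⁆ Module.End K (V ⧸ c.restrictScalars K) :=
    { toFun := fun a => (c.restrictScalars K).mapQ (c.restrictScalars K) (a.restrictScalars K)
        (hcinv a)
      map_add' := fun _ _ => by ext; rfl
      map_smul' := fun _ _ => by ext; rfl
      map_lie' := by intros; ext; rfl }
  refine ⟨f₁.prod f₂, (injective_iff_map_eq_zero _).2 fun a ha => ?_⟩
  have h1 : ∀ v ∈ c, a v = 0 := fun v hv =>
    congrArg Subtype.val (LinearMap.congr_fun (congrArg Prod.fst ha) ⟨v, hv⟩)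
  have h2 : ∀ v, a v ∈ c := fun v => by
    have := LinearMap.congr_fun (congrArg Prod.snd ha) (Submodule.Quotient.mk v)
    exact (Submodule.Quotient.mk_eq_zero (c.restrictScalars K)).1 this
  have hcmem : c ∈ isotypicComponents R V := ⟨U, inferInstance, rfl⟩
  have h3 : (⊤ : Submodule R V) ≤ LinearMap.ker a := by
    rw [← sSup_isotypicComponents R V, sSup_le_iff]
    intro c' hc' v hv
    rw [LinearMap.mem_ker]
    by_cases hcc : c' = c
    · exact h1 v (hcc ▸ hv)
    -- On another component the values of `a` lie in `c'` by full invariance and in `c` by `h2`.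
    · have hd : Disjoint c' c :=
        (sSupIndep_isotypicComponents R V).pairwiseDisjoint hc' hcmem hcc
      exact (Submodule.disjoint_def.1 hd) _
        (Submodule.IsFullyInvariant.of_mem_isotypicComponents hc' a hv) (h2 v)
  ext v
  exact h3 (Submodule.mem_top (x := v))

variable [IsAlgClosed K]

/-- Schur's lemma gives `End U = K`, hence `End (U^k)` is the algebra of `k × k` matrices over `K`.
-/
theorem embeds_end_of_isotypic {U : Type*} [AddCommGroup U]
    [Module K U] [Module R U] [IsScalarTower K R U] [IsSimpleModule R U] [FiniteDimensional K U]
    {k : ℕ} (e : V ≃ₗ[R] (Fin k → U)) :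
    Embeds K (Module.End R V) (Matrix (Fin k) (Fin k) K) := by
  let s : K ≃ₐ[K] Module.End R U := AlgEquiv.ofBijective (Algebra.ofId K _)
    (IsSimpleModule.algebraMap_end_bijective_of_isAlgClosed K)
  let E : Module.End R V ≃ₐ[K] Matrix (Fin k) (Fin k) K :=
    ((e.conjAlgEquiv K).trans (endVecAlgEquivMatrixEnd (Fin k) K R U)).trans s.symm.mapMatrix
  exact Embeds.of_algHom E.toAlgHom E.injective

theorem embeds_end_of_two_le_finrank [FiniteDimensional K V] [IsSemisimpleModule R V] (U : Submodule R V)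
    [IsSimpleModule R U] (hU : 2 ≤ Module.finrank K U) {m : ℕ}
    (hm : m + Module.finrank K U = Module.finrank K V) :
    Embeds K (Module.End R V) (Matrix (Fin m) (Fin m) K × K) := by
  have h := embeds_end_prod_of_isotypicComponent (K := K) U
  set c := isotypicComponent R V U
  have hfin : FiniteDimensional K c :=
    inferInstanceAs (FiniteDimensional K (c.restrictScalars K))
  have hfinU : FiniteDimensional K U :=
    inferInstanceAs (FiniteDimensional K (U.restrictScalars K))
  have : Module.Finite R c := Module.Finite.of_restrictScalars_finite K R c
  obtain ⟨k, ⟨e⟩⟩ := (IsIsotypicOfType.isotypicComponent R V U).linearEquiv_fun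
  have hk : Module.finrank K c = k * Module.finrank K U := by
    rw [(e.restrictScalars K).finrank_eq, Module.finrank_pi_fintype]
    simp
  have hq := Submodule.finrank_quotient_add_finrank (c.restrictScalars K)
  have hq' : Module.finrank K (V ⧸ c.restrictScalars K) + Module.finrank K c
    = Module.finrank K V := hq
  have h' := h.trans (Embeds.prodMap (embeds_end_of_isotypic (K := K) e) embeds_end_matrix)
  have hk0 : k ≠ 0 := by
    rintro rfl
    have hn : Nontrivial c :=
      Submodule.nontrivial_iff_ne_bot.2 (bot_lt_isotypicComponent U).ne'
    exact not_subsingleton c e.toEquiv.subsingleton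
  rcases Nat.lt_or_ge k 2 with hk2 | hk2
  · obtain rfl : k = 1 := by omega
    have hdim : Module.finrank K (V ⧸ c.restrictScalars K) = m := by omega
    rw [hdim] at h'
    refine h'.trans (Embeds.trans (L₂ := Matrix (Fin m) (Fin m) K × Matrix (Fin 1) (Fin 1) K)
      ⟨(LieEquiv.prodComm K _ _).toLieHom, (LieEquiv.prodComm K _ _).injective⟩
      (Embeds.prodMap ⟨LieHom.id, Function.injective_id⟩ ?_))
    refine ⟨{ toFun := fun A => A 0 0
              map_add' := fun _ _ => rfl
              map_smul' := fun _ _ => rfl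
              map_lie' := by
                simp [LieRing.of_associative_ring_bracket, Matrix.mul_apply] }, fun A B h => ?_⟩
    ext i j
    rw [Subsingleton.elim i 0, Subsingleton.elim j 0]
    exact h
  -- For `k ≥ 2` and `dim U ≥ 2` one has `k ≤ (k - 1) * dim U`, so both factors fit into size `m`
  -- and the scalar coordinate is set to zero.
  · refine h'.trans (Embeds.trans (embeds_matrix_prod (m := m) ?_)
      ⟨LieHom.inl K _ _, LieHom.inl_injective⟩)
    simp only [Fintype.card_fin]
    obtain ⟨j, rfl⟩ := Nat.exists_eq_add_of_le hk2
    rw [hk] at hq'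
    nlinarith
end
end FaithfulRep

/-! ### Centralizers of simple Lie algebras and the inductive compression. -/

namespace FaithfulRep
section
variable {K : Type*} [Field K]

theorem lie_eq_zero_of_commRing {A : Type*} [CommRing A] (a b : A) : ⁅a, b⁆ = 0 := by
  rw [LieRing.of_associative_ring_bracket, mul_comm, sub_self]

theorem mu_le {L : Type*} [LieRing L] [LieAlgebra K L] {n : ℕ}
    (h : Embeds K L (Matrix (Fin n) (Fin n) K)) : mu K L ≤ n :=
  Nat.sInf_le h

theorem two_le_of_embeds {L : Type*} [LieRing L] [LieAlgebra K L] {n : ℕ}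
    (hL : ¬ IsLieAbelian L) (h : Embeds K L (Matrix (Fin n) (Fin n) K)) : 2 ≤ n := by
  by_contra hn
  have hsub : Subsingleton (Fin n) := Fin.subsingleton_iff_le_one.2 (by omega)
  obtain ⟨f, hf⟩ := h
  refine hL ⟨fun x y => hf ?_⟩
  rw [LieHom.map_lie, map_zero f, LieRing.of_associative_ring_bracket, sub_eq_zero]
  ext i j
  rw [Matrix.mul_apply, Matrix.mul_apply]
  refine Finset.sum_congr rfl fun k _ => ?_
  rw [Subsingleton.elim i k, Subsingleton.elim j k, mul_comm]

/-- Corestriction of a Lie algebra homomorphism to an associative subalgebra. -/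
def codRestrict {L A : Type*} [LieRing L] [LieAlgebra K L] [Ring A] [Algebra K A]
    (C : Subalgebra K A) (f : L →ₗ⁅K⁆ A) (h : ∀ x, f x ∈ C) : L →ₗ⁅K⁆ C where
  toFun x := ⟨f x, h x⟩
  map_add' x y := Subtype.ext (map_add f x y)
  map_smul' c x := Subtype.ext (map_smul f c x)
  map_lie' {x y} := Subtype.ext (f.map_lie x y)

variable [IsAlgClosed K] [CharZero K] {L : Type*} [LieRing L] [LieAlgebra K L] [FiniteDimensional K L]
  [IsSimple K L]

/-- The centralizer of a faithful representation of a simple Lie algebra. -/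
theorem embeds_centralizer_end {V : Type*} [AddCommGroup V] [Module K V] [FiniteDimensional K V]
    (f : L →ₗ⁅K⁆ Module.End K V) (hf : Function.Injective f) :
    ∃ m, m + mu K L = Module.finrank K V ∧
      Embeds K (Subalgebra.centralizer K (Set.range f)) (Matrix (Fin m) (Fin m) K × K) := by
  let _ : LieRingModule L V := LieRingModule.compLieHom V f
  have : LieModule K L V := LieModule.compLieHom V f
  have hss := LieModule.isSemisimpleModule_adjoin_range_toEnd K L V
  set R := Algebra.adjoin K (Set.range (toEnd K L V))
  -- If `L` acted trivially on every simple submodule, it would act trivially on their sum `V`,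
  -- contradicting faithfulness.
  obtain ⟨U, hU, x₀, u₀, hu₀, hx₀⟩ : ∃ U : Submodule R V, IsSimpleModule R U ∧
      ∃ x : L, ∃ u ∈ U, ⁅x, u⁆ ≠ 0 := by
    by_contra! hcon
    let Z : Submodule R V :=
      { (maxTrivSubmodule K L V : Submodule K V) with
        smul_mem' := fun r _ hv =>
          (maxTrivSubmodule K L V).apply_mem_of_mem_adjoin_range_toEnd r.2 hv }
    have hZ : ⊤ ≤ Z := by
      rw [← IsSemisimpleModule.sSup_simples_eq_top R V, sSup_le_iff]
      intro U hU u hu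
      exact (mem_maxTrivSubmodule (R := K) (L := L) (M := V) u).2 fun x => hcon U hU x u hu
    refine IsSimple.non_abelian K (L := L) ⟨fun x y => hf ?_⟩
    have h0 : ∀ x, f x = 0 := fun x => by
      ext v
      exact (mem_maxTrivSubmodule (R := K) (L := L) (M := V) v).1 (hZ (Submodule.mem_top (x := v))) x
    rw [h0, h0]
  let U₀ : LieSubmodule K L V :=
    { U.restrictScalars K with
      lie_mem := fun {x v} hv =>
        U.smul_mem (⟨toEnd K L V x, Algebra.subset_adjoin ⟨x, rfl⟩⟩ : R) hv }
  have hinj : Function.Injective (toEnd K L U₀) := by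
    refine IsSimple.injective_of_ne_zero _ fun h => hx₀ ?_
    exact congrArg Subtype.val (LinearMap.congr_fun (LieHom.congr_fun h x₀) ⟨u₀, hu₀⟩)
  have hemb : Embeds K L (Matrix (Fin (Module.finrank K U₀)) (Fin (Module.finrank K U₀)) K) :=
    Embeds.trans ⟨_, hinj⟩ embeds_end_matrix
  have hmu := mu_le hemb
  have hle : Module.finrank K U₀ ≤ Module.finrank K V :=
    Submodule.finrank_le (U₀ : Submodule K V)
  have hC : Embeds K (Subalgebra.centralizer K (Set.range f)) (Module.End R V) := by
    have hcom : ∀ a ∈ Subalgebra.centralizer K (Set.range f), ∀ r ∈ R, a * r = r * a :=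
      fun a ha r hr => (Subalgebra.mem_centralizer_iff K).1
        (Algebra.adjoin_le_centralizer_centralizer K _ hr) a ha
    refine Embeds.of_algHom (AlgHom.ofLinearMap
      { toFun := fun a =>
          { toFun := a.1
            map_add' := map_add a.1
            map_smul' := fun r v => LinearMap.congr_fun (hcom a.1 a.2 r.1 r.2) v }
        map_add' := fun _ _ => rfl
        map_smul' := fun _ _ => rfl } rfl fun _ _ => rfl) fun a b hab => ?_
    ext v
    exact LinearMap.congr_fun hab v
  have hV := embeds_end_of_two_le_finrank (K := K) U
    (two_le_of_embeds (IsSimple.non_abelian K) hemb) (Nat.sub_add_cancel hle)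
  refine ⟨Module.finrank K V - mu K L, Nat.sub_add_cancel (hmu.trans hle), hC.trans (hV.trans
    (Embeds.prodMap (embeds_matrix ?_) ⟨LieHom.id, Function.injective_id⟩))⟩
  rw [Fintype.card_fin]
  exact Nat.sub_le_sub_left hmu _

theorem embeds_centralizer_matrix {n : ℕ} (f : L →ₗ⁅K⁆ Matrix (Fin n) (Fin n) K)
    (hf : Function.Injective f) :
    ∃ m, m + mu K L = n ∧
      Embeds K (Subalgebra.centralizer K (Set.range f)) (Matrix (Fin m) (Fin m) K × K) := by
  let e : Matrix (Fin n) (Fin n) K ≃ₐ[K] Module.End K (Fin n → K) := Matrix.toLinAlgEquiv'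
  let g : Matrix (Fin n) (Fin n) K →ₗ⁅K⁆ Module.End K (Fin n → K) := e.toAlgHom.toLieHom
  obtain ⟨m, hm, h⟩ := embeds_centralizer_end (g.comp f)
    (e.injective.comp hf)
  refine ⟨m, by simpa using hm, Embeds.trans ⟨codRestrict _
    (g.comp
      (Subalgebra.centralizer K (Set.range f)).val.toLieHom) ?_, ?_⟩ h⟩
  · intro a
    rw [Subalgebra.mem_centralizer_iff]
    rintro _ ⟨x, rfl⟩
    have := (Subalgebra.mem_centralizer_iff K).1 a.2 (f x) ⟨x, rfl⟩
    change e (f x) * e a.1 = e a.1 * e (f x)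
    rw [← map_mul, ← map_mul, this]
  · intro a b hab
    exact Subtype.ext (e.injective (congrArg Subtype.val hab))

/-- Prepending a coordinate, as a homomorphism of abelian Lie algebras. -/
def consLieHom (K : Type*) [Field K] (k : ℕ) : K × (Fin k → K) →ₗ⁅K⁆ (Fin (k + 1) → K) where
  toFun p := Fin.cons p.1 p.2
  map_add' p q := by
    ext i; refine Fin.cases ?_ (fun i => ?_) i <;> simp
  map_smul' c p := by
    ext i; refine Fin.cases ?_ (fun i => ?_) i <;> simp
  map_lie' {p q} := by
    ext i
    refine Fin.cases ?_ (fun i => ?_) i <;>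
      simp [LieRing.of_associative_ring_bracket, mul_comm]

omit [LieRing L] [LieAlgebra K L] [FiniteDimensional K L] [IsSimple K L] in
/-- If simple Lie algebras `S i` act faithfully on `Kⁿ` and these actions commute with each other
and with the action `h` of a further Lie algebra `A`, then the latter can be compressed. -/
theorem exists_lieHom_of_commuting {A : Type*} [LieRing A] [LieAlgebra K A] {k : ℕ} :
    ∀ {S : Fin k → Type*} [∀ i, LieRing (S i)] [∀ i, LieAlgebra K (S i)]
      [∀ i, FiniteDimensional K (S i)] [∀ i, IsSimple K (S i)] {n : ℕ}
      (f : ∀ i, S i →ₗ⁅K⁆ Matrix (Fin n) (Fin n) K) (_ : ∀ i, Function.Injective (f i))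
      (_ : ∀ i j, i ≠ j → ∀ x y, ⁅f i x, f j y⁆ = 0)
      (h : A →ₗ⁅K⁆ Matrix (Fin n) (Fin n) K) (_ : ∀ i x a, ⁅f i x, h a⁆ = 0),
      ∃ m, m + ∑ i, mu K (S i) = n ∧
        ∃ ψ : A →ₗ⁅K⁆ Matrix (Fin m) (Fin m) K × (Fin k → K), ∀ a, ψ a = 0 → h a = 0 := by
  induction k with
  | zero =>
    intro S _ _ _ _ n f _ _ h _
    exact ⟨n, by simp, h.prod 0, fun a ha => congrArg Prod.fst ha⟩
  | succ k ih =>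
    intro S _ _ _ _ n f hf hcomm h hh
    obtain ⟨m₁, hm₁, φ, hφ⟩ := embeds_centralizer_matrix (f 0) (hf 0)
    have hmem : ∀ X, (∀ x, ⁅f 0 x, X⁆ = 0) → X ∈ Subalgebra.centralizer K (Set.range (f 0)) := by
      intro X hX
      rw [Subalgebra.mem_centralizer_iff]
      rintro _ ⟨x, rfl⟩
      exact sub_eq_zero.1 (hX x)
    let fC : ∀ i : Fin k, S i.succ →ₗ⁅K⁆ Subalgebra.centralizer K (Set.range (f 0)) := fun i =>
      codRestrict _ (f i.succ) fun y => hmem _ fun x => hcomm 0 i.succ (Fin.succ_ne_zero i).symm x y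
    let hC : A →ₗ⁅K⁆ Subalgebra.centralizer K (Set.range (f 0)) :=
      codRestrict _ h fun a => hmem _ fun x => hh 0 x a
    let π := (LieHom.fst K (Matrix (Fin m₁) (Fin m₁) K) K).comp φ
    -- Dropping the abelian factor `K` loses nothing on a simple algebra: if `π` killed it, its
    -- brackets would have zero image under the injective `φ`.
    have hinj : ∀ i, Function.Injective (π.comp (fC i)) := fun i => by
      refine IsSimple.injective_of_ne_zero _ fun h0 => IsSimple.non_abelian K (L := S i.succ) ?_
      have h1 : ∀ x, (φ (fC i x)).1 = 0 := fun x => LieHom.congr_fun h0 x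
      refine ⟨fun x y => ?_⟩
      have h2 : φ (fC i ⁅x, y⁆) = 0 := by
        refine Prod.ext (h1 _) ?_
        rw [LieHom.map_lie, LieHom.map_lie]
        exact lie_eq_zero_of_commRing _ _
      have h3 := hφ (h2.trans (map_zero φ).symm)
      exact hf i.succ ((congrArg Subtype.val h3).trans (map_zero _).symm)
    obtain ⟨m, hm, ψ, hψ⟩ := ih (fun i => π.comp (fC i)) hinj
      (fun i j hij x y => by
        have h1 : ⁅fC i x, fC j y⁆ = 0 :=
          Subtype.ext (hcomm i.succ j.succ (fun h => hij (Fin.succ_injective k h)) x y)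
        exact (π.map_lie _ _).symm.trans ((congrArg π h1).trans (map_zero π)))
      -- This map can have a larger kernel than `h`, because the scalar coordinate is dropped. Hence
      -- the induction compares kernels instead of assuming injectivity, and the coordinate is
      -- restored in the final `ψ`.
      (π.comp hC)
      (fun i x a => by
        have h1 : ⁅fC i x, hC a⁆ = 0 := Subtype.ext (hh i.succ x a)
        exact (π.map_lie _ _).symm.trans ((congrArg π h1).trans (map_zero π)))
    refine ⟨m, by rw [Fin.sum_univ_succ]; omega, ((LieHom.fst K _ _).comp ψ).prod
      ((consLieHom K k).comp ((((LieHom.snd K _ _).comp φ).comp hC).prod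
        ((LieHom.snd K _ _).comp ψ))), fun a ha => ?_⟩
    have h1 : (ψ a).1 = 0 := congrArg Prod.fst ha
    have h2 : (Fin.cons (φ (hC a)).2 (ψ a).2 : Fin (k + 1) → K) = 0 := congrArg Prod.snd ha
    have h3 : (φ (hC a)).2 = 0 := congrFun h2 0
    have h4 : (ψ a).2 = 0 := funext fun i => congrFun h2 i.succ
    have h5 : (φ (hC a)).1 = 0 := hψ a (Prod.ext h1 h4)
    have h6 := hφ ((Prod.ext h5 h3 : φ (hC a) = 0).trans (map_zero φ).symm)
    exact congrArg Subtype.val h6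
end
end FaithfulRep

/-! ### Semisimple Lie algebras: simple ideals, the block construction, the equivalence. -/

namespace FaithfulRep
section
variable {K : Type*} [Field K] {L : Type*} [LieRing L] [LieAlgebra K L]

theorem isAtom_of_isSimple (I : LieIdeal K L) (hI : IsSimple K I) : IsAtom I := by
  refine ⟨?_, fun J hJ => ?_⟩
  · rintro rfl
    have := IsSimple.nontrivial K (⊥ : LieIdeal K L)
    exact not_subsingleton (⊥ : LieIdeal K L) inferInstance
  · rcases hI.eq_bot_or_eq_top (J.comap I.incl) with h | h
    · rw [eq_bot_iff]
      intro x hx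
      have hx' : (⟨x, hJ.le hx⟩ : I) ∈ J.comap I.incl := LieIdeal.mem_comap.2 hx
      rw [h, LieSubmodule.mem_bot] at hx'
      exact congrArg Subtype.val hx'
    · refine absurd (fun x hx => ?_) hJ.not_ge
      have : (⟨x, hx⟩ : I) ∈ J.comap I.incl := h ▸ LieSubmodule.mem_top _
      exact LieIdeal.mem_comap.1 this

variable [FiniteDimensional K L] [LieAlgebra.IsSemisimple K L]

variable (K L) in
-- Independence of the simple ideals makes them finite in number, so the `ncard` in `length` is a
-- true count and not its default value 0.
theorem exists_equiv_simple_ideals :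
    Nonempty (Fin (length K L) ≃ {I : LieIdeal K L | IsSimple K I}) := by
  have hfin : {I : LieIdeal K L | IsSimple K I}.Finite :=
    (WellFoundedGT.finite_of_sSupIndep (IsSemisimple.sSupIndep_isAtom (R := K) (L := L))).subset
      fun I hI => isAtom_of_isSimple I hI
  have := hfin.to_subtype
  exact ⟨(Finite.equivFinOfCardEq (Nat.card_coe_set_eq _)).symm⟩

omit [FiniteDimensional K L] in
theorem lie_eq_zero_of_simple_ideals_ne {I J : LieIdeal K L} (hI : IsSimple K I)
    (hJ : IsSimple K J) (h : I ≠ J) {x y : L} (hx : x ∈ I) (hy : y ∈ J) : ⁅x, y⁆ = 0 := by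
  have hd : Disjoint I J := (IsSemisimple.sSupIndep_isAtom (R := K) (L := L)).pairwiseDisjoint
    (isAtom_of_isSimple I hI) (isAtom_of_isSimple J hJ) h
  have : ⁅x, y⁆ ∈ I ⊓ J := ⟨lie_mem_left K L I x y hx, lie_mem_right K L J x y hy⟩
  rwa [hd.eq_bot, LieSubmodule.mem_bot] at this

omit [FiniteDimensional K L] in
/-- An ideal of a semisimple Lie algebra is a retract. -/
theorem exists_lieHom_retraction (I : LieIdeal K L) :
    ∃ p : L →ₗ⁅K⁆ I, ∀ x : I, p x = x := by
  have hc : IsCompl I Iᶜ := isCompl_compl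
  have hc' : IsCompl (I : Submodule K L) (Iᶜ : LieIdeal K L) :=
    (LieSubmodule.isCompl_toSubmodule).2 hc
  let p : L →ₗ[K] I := Submodule.projectionOnto _ _ hc'
  have hpI : ∀ x ∈ I, (p x : L) = x := fun x hx =>
    congrArg Subtype.val (Submodule.projectionOnto_apply_left hc' ⟨x, hx⟩)
  have hp0 : ∀ x ∈ Iᶜ, p x = 0 := fun x hx =>
    (Submodule.projectionOnto_apply_eq_zero_iff hc').2 hx
  have hdec : ∀ x : L, ∃ a ∈ I, ∃ b ∈ Iᶜ, a + b = x := fun x => by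
    have : x ∈ (I : Submodule K L) ⊔ (Iᶜ : LieIdeal K L) := by
      rw [codisjoint_iff.1 hc'.2]; trivial
    exact Submodule.mem_sup.1 this
  have h0 : ∀ a ∈ I, ∀ b ∈ Iᶜ, ⁅a, b⁆ = 0 := fun a ha b hb => by
    have : ⁅a, b⁆ ∈ I ⊓ Iᶜ := ⟨lie_mem_left K L I a b ha, lie_mem_right K L _ a b hb⟩
    rwa [hc.1.eq_bot, LieSubmodule.mem_bot] at this
  refine ⟨{ p with map_lie' := fun {x y} => ?_ }, fun x => Subtype.ext (hpI x x.2)⟩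
  change p ⁅x, y⁆ = ⁅p x, p y⁆
  obtain ⟨a, ha, b, hb, rfl⟩ := hdec x
  obtain ⟨a', ha', b', hb', rfl⟩ := hdec y
  ext
  have h1 : ⁅b, a'⁆ = 0 := by rw [← lie_skew, h0 a' ha' b hb, neg_zero]
  have h2 : ⁅a + b, a' + b'⁆ = ⁅a, a'⁆ + ⁅b, b'⁆ := by
    rw [add_lie, lie_add, lie_add, h0 a ha b' hb', h1, add_zero, zero_add]
  have h3 : (p (a + b) : L) = a := by rw [map_add, hp0 b hb, add_zero, hpI a ha]
  have h4 : (p (a' + b') : L) = a' := by rw [map_add, hp0 b' hb', add_zero, hpI a' ha']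
  rw [h2, map_add, hp0 _ (lie_mem_left K L _ b b' hb), add_zero,
    hpI _ (lie_mem_left K L I a a' ha)]
  change ⁅a, a'⁆ = ⁅(p (a + b) : L), (p (a' + b') : L)⁆
  rw [h3, h4]

theorem embeds_prod_matrix {k : ℕ} (e : Fin k ≃ {I : LieIdeal K L | IsSimple K I}) {m n : ℕ}
    (hn : m + ∑ i, mu K (e i).1 ≤ n) :
    Embeds K (L × (Matrix (Fin m) (Fin m) K × (Fin k → K))) (Matrix (Fin n) (Fin n) K) := by
  have hs : ∀ i, IsSimple K (e i).1 := fun i => (e i).2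
  choose p hp using fun i => exists_lieHom_retraction (e i).1
  choose f hf using fun i => embeds_mu K (e i).1
  let F : ∀ i, L →ₗ⁅K⁆ Matrix (Fin (mu K (e i).1)) (Fin (mu K (e i).1)) K :=
    fun i => (f i).comp (p i)
  have hpos : ∀ i, 0 < mu K (e i).1 := fun i => by
    have := two_le_of_embeds (IsSimple.non_abelian K) (embeds_mu K (e i).1)
    omega
  -- A nonzero joint kernel would contain an atom, that is a simple ideal `e i`, on which `F i` is
  -- faithful.
  have hF : ∀ x, (∀ i, F i x = 0) → x = 0 := by
    intro x hx
    let J : LieIdeal K L := ⨅ i, (F i).ker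
    have hJ : J = ⊥ := by
      by_contra hJ
      obtain ⟨I, hI, hIJ⟩ := (IsAtomic.eq_bot_or_exists_atom_le J).resolve_left hJ
      have hIs := IsSemisimple.isSimple_of_isAtom I hI
      obtain ⟨i, hi⟩ := e.surjective ⟨I, hIs⟩
      have hi' : (e i).1 = I := congrArg Subtype.val hi
      refine hI.1 ?_
      rw [eq_bot_iff]
      intro y hy
      have hyJ : y ∈ (F i).ker := iInf_le (fun i => (F i).ker) i (hIJ hy)
      have h1 : f i (p i y) = 0 := (LieHom.mem_ker).1 hyJ
      have h2 : p i y = 0 := hf i (h1.trans (map_zero _).symm)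
      rw [← hi'] at hy
      rw [hp i ⟨y, hy⟩] at h2
      exact congrArg Subtype.val h2
    have : x ∈ J := by
      simp only [J, LieSubmodule.mem_iInf]
      exact fun i => (LieHom.mem_ker).2 (hx i)
    rwa [hJ, LieSubmodule.mem_bot] at this
  let D : L × (Matrix (Fin m) (Fin m) K × (Fin k → K)) →
      ∀ i, Matrix (Fin (mu K (e i).1)) (Fin (mu K (e i).1)) K :=
    fun z i => F i z.1 + z.2.2 i • 1
  let G : L × (Matrix (Fin m) (Fin m) K × (Fin k → K)) →ₗ⁅K⁆
      Matrix (Fin m) (Fin m) K ×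
        Matrix (Σ i, Fin (mu K (e i).1)) (Σ i, Fin (mu K (e i).1)) K :=
    { toFun := fun z => (z.2.1, Matrix.blockDiagonal' (D z))
      map_add' := fun z w => Prod.ext rfl <| by
        change Matrix.blockDiagonal' (D (z + w)) =
          Matrix.blockDiagonal' (D z) + Matrix.blockDiagonal' (D w)
        rw [← Matrix.blockDiagonal'_add]
        congr 1
        funext i
        simp only [D, Prod.fst_add, Prod.snd_add, Pi.add_apply, map_add, add_smul]
        abel
      map_smul' := fun c z => Prod.ext rfl <| by
        change Matrix.blockDiagonal' (D (c • z)) = c • Matrix.blockDiagonal' (D z)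
        rw [← Matrix.blockDiagonal'_smul]
        congr 1
        funext i
        simp [D, mul_smul]
      map_lie' := fun {z w} => Prod.ext rfl <| by
        change Matrix.blockDiagonal' (D ⁅z, w⁆) =
          Matrix.blockDiagonal' (D z) * Matrix.blockDiagonal' (D w) -
            Matrix.blockDiagonal' (D w) * Matrix.blockDiagonal' (D z)
        rw [← Matrix.blockDiagonal'_mul, ← Matrix.blockDiagonal'_mul, ← Matrix.blockDiagonal'_sub]
        congr 1
        funext i
        have h1 : (⁅z, w⁆.2.2) i = 0 := lie_eq_zero_of_commRing (z.2.2 i) (w.2.2 i)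
        have h2 : F i ⁅z, w⁆.1 = F i z.1 * F i w.1 - F i w.1 * F i z.1 := (F i).map_lie z.1 w.1
        simp only [Pi.sub_apply, D]
        rw [h1, h2]
        simp only [add_mul, mul_add, zero_smul, add_zero, smul_mul_assoc, mul_smul_comm, one_mul,
          mul_one, smul_add]
        rw [smul_comm (z.2.2 i)]
        abel }
  refine Embeds.trans ⟨G, (injective_iff_map_eq_zero _).2 fun z hz => ?_⟩
    (embeds_matrix_prod (by simpa using hn))
  have hz1 : z.2.1 = 0 := congrArg Prod.fst hz
  have hz2 : ∀ i, F i z.1 + z.2.2 i • 1 = 0 := by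
    have h1 : Matrix.blockDiagonal' (D z) = Matrix.blockDiagonal' 0 := (congrArg Prod.snd hz).trans Matrix.blockDiagonal'_zero.symm
    exact congrFun (Matrix.blockDiagonal'_injective h1)
  -- Every `F i z.1` is scalar, so `z.1` is central by joint faithfulness, and the center is zero.
  have hz3 : z.1 = 0 := by
    have hmem : z.1 ∈ LieAlgebra.center K L := by
      intro y
      refine hF _ fun i => ?_
      rw [LieHom.map_lie, eq_neg_of_add_eq_zero_left (hz2 i),
        LieRing.of_associative_ring_bracket]
      simp
    rwa [LieAlgebra.center_eq_bot, LieSubmodule.mem_bot] at hmem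
  refine Prod.ext hz3 (Prod.ext hz1 (funext fun i => ?_))
  have h := hz2 i
  rw [hz3, map_zero (F i), zero_add] at h
  have := congrFun (congrFun h ⟨0, hpos i⟩) ⟨0, hpos i⟩
  simpa using this

variable [IsAlgClosed K] [CharZero K]

theorem exists_embeds_of_embeds_prod {k : ℕ} (e : Fin k ≃ {I : LieIdeal K L | IsSimple K I})
    {A : Type*} [LieRing A] [LieAlgebra K A] {n : ℕ}
    (f : L →ₗ⁅K⁆ Matrix (Fin n) (Fin n) K) (hf : Function.Injective f)
    (h : A →ₗ⁅K⁆ Matrix (Fin n) (Fin n) K) (hh : ∀ x a, ⁅f x, h a⁆ = 0) :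
    ∃ m, m + ∑ i, mu K (e i).1 = n ∧
      ∃ ψ : A →ₗ⁅K⁆ Matrix (Fin m) (Fin m) K × (Fin k → K), ∀ a, ψ a = 0 → h a = 0 := by
  have hs : ∀ i, IsSimple K (e i).1 := fun i => (e i).2
  refine exists_lieHom_of_commuting (S := fun i => (e i).1)
    (fun i => f.comp (LieIdeal.incl (e i).1)) (fun i => hf.comp Subtype.val_injective)
    (fun i j hij x y => ?_) h fun i x a => hh _ _
  have hne : (e i).1 ≠ (e j).1 := fun h => hij (e.injective (Subtype.ext h))
  have h0 := lie_eq_zero_of_simple_ideals_ne (hs i) (hs j) hne x.2 y.2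
  rw [LieHom.comp_apply, LieHom.comp_apply, ← LieHom.map_lie]
  exact (congrArg f h0).trans (map_zero f)

/-- The minimal dimension of a faithful representation is additive over the simple ideals. -/
theorem sum_mu_eq_mu {k : ℕ} (e : Fin k ≃ {I : LieIdeal K L | IsSimple K I}) :
    ∑ i, mu K (e i).1 = mu K L := by
  apply le_antisymm
  -- Only the dimension count is needed, so the commuting action is taken to be zero.
  · obtain ⟨f, hf⟩ := embeds_mu K L
    obtain ⟨m, hm, -⟩ := exists_embeds_of_embeds_prod e f hf
      (0 : L →ₗ⁅K⁆ Matrix (Fin (mu K L)) (Fin (mu K L)) K) (fun x a => lie_zero _)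
    omega
  · exact mu_le (Embeds.trans ⟨LieHom.inl K _ _, LieHom.inl_injective⟩
      (embeds_prod_matrix e (m := 0) (by simp)))

theorem embeds_prod_iff (A : Type*) [LieRing A] [LieAlgebra K A] (n : ℕ) (hn : mu K L ≤ n) :
    Embeds K (L × A) (Matrix (Fin n) (Fin n) K) ↔
      Embeds K A (Matrix (Fin (n - mu K L)) (Fin (n - mu K L)) K × (Fin (length K L) → K)) := by
  obtain ⟨e⟩ := exists_equiv_simple_ideals K L
  have hsum := sum_mu_eq_mu e
  constructor
  · rintro ⟨F, hF⟩
    obtain ⟨m, hm, ψ, hψ⟩ := exists_embeds_of_embeds_prod e (F.comp (LieHom.inl K L A))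
      (hF.comp LieHom.inl_injective) (F.comp (LieHom.inr K L A)) fun x a => by
        rw [LieHom.comp_apply, LieHom.comp_apply, ← LieHom.map_lie]
        simp [LieAlgebra.Prod.bracket_apply, ← Prod.zero_eq_mk]
    -- By additivity of `mu` the compressed size is exactly `n - mu K L`.
    obtain rfl : m = n - mu K L := by omega
    refine ⟨ψ, (injective_iff_map_eq_zero _).2 fun a ha => ?_⟩
    exact congrArg Prod.snd (hF ((hψ a ha).trans (map_zero F).symm))
  · intro h
    exact (Embeds.prodMap ⟨LieHom.id, Function.injective_id⟩ h).trans
      (embeds_prod_matrix e (by omega))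
end
end FaithfulRep

theorem mainTheorem4 (𝔤 : Type*) [LieRing 𝔤] [LieAlgebra ℂ 𝔤] [FiniteDimensional ℂ 𝔤]
    [LieAlgebra.IsSemisimple ℂ 𝔤] (𝔞 : Type*) [LieRing 𝔞] [LieAlgebra ℂ 𝔞]
    (n : ℕ) (hn : FaithfulRep.mu ℂ 𝔤 ≤ n) :
    FaithfulRep.Embeds ℂ (𝔤 × 𝔞) (Matrix (Fin n) (Fin n) ℂ) ↔
      FaithfulRep.Embeds ℂ 𝔞
        (Matrix (Fin (n - FaithfulRep.mu ℂ 𝔤)) (Fin (n - FaithfulRep.mu ℂ 𝔤)) ℂ ×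
          (Fin (FaithfulRep.length ℂ 𝔤) → ℂ)) := by
  exact FaithfulRep.embeds_prod_iff 𝔞 n hn
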